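/- Consider finite mixed graphs (directed $\to$, bidirected $\leftrightarrow$ and undirected $-$ edges, at most one edge between two nodes, no loops). Paths consist of distinct nodes; $U$ is an ancestor of $V$ if $U=V$ or there is a directed path from $U$ to $V$, and $U$ is anterior to $V$ if there is a (possibly trivial) path $U - \dots - W \to \dots \to V$, where either part may be empty. An inner node of a path is a collider on it if both path edges at it have an arrowhead at it, and a noncollider otherwise. A path between $A$ and $B$ is unblocked relative to a set $\mathbf{W}$ if no noncollider on it is in $\mathbf{W}$ and every collider on it is an ancestor of a node of $\mathbf{W}$. A set $\mathbf{W}\subseteq V\setminus\{A,B\}$ separates two distinct nodes $A,B$ if no path between them is unblocked relative to $\mathbf{W}$; it is a minimal separating set if moreover no proper subset of it separates them. The graph is ancestral if an arrowhead at $U$ on an edge to $V$ implies that $U$ is not an ancestor of $V$ and that $U$ has no undirected edges; it is a maximal ancestral graph (MAG) if moreover any two distinct nonadjacent nodes are separated by some set. Let $Adj(\{X,Y\})$ be the set of nodes adjacent to $X$ or $Y$, and let $AA(\{X,Y\})$ be the set of nodes outside $\{X,Y\}$ that are adjacent to $X$ or $Y$ and anterior to $X$ or $Y$. A set $\mathbf{Z}$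 D-separates $X$ and $Y$ if it separates them while no subset of $Adj(\{X,Y\})\setminus\{X,Y\}$ does; $(X,Y)$ is a D-sep link if some set D-separates $X$ and $Y$. If $\mathbf{Z}$ D-separates $X$ and $Y$, a node $Z\in\mathbf{Z}$ is a D-sep node for $(X,Y)$ if $Z\notin Adj(\{X,Y\})$ and, for every $\mathbf{Z}'\subseteq Adj(\{X,Y\})$, the set $(\mathbf{Z}\setminus\{Z\})\cup\mathbf{Z}'$ does not separate $X$ and $Y$. **Lemma.** Let $\mathcal{M}$ be a MAG with D-sep link $(X,Y)$, and let $\mathbf{Z}_{DS}$ be a set such that $AA(\{X,Y\})\cup\mathbf{Z}_{DS}$ separates $X$ and $Y$, while $AA(\{X,Y\})\cup\mathbf{Z}'$ does not for any proper subset $\mathbf{Z}'\subsetneq\mathbf{Z}_{DS}$. Then all nodes of $\mathbf{Z}_{DS}$ are D-sep nodes for $(X,Y)$ (with respect to the D-separating set $AA(\{X,Y\})\cup\mathbf{Z}_{DS}$), and they can be found one after another, as follows: there is an enumeration $z_1,\dots,z_n$ of $\mathbf{Z}_{DS}$ without repetitions such that, for every $i$, the node $z_i$ belongs to some minimal separating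 set in $\mathcal{M}$ between two nodes $A,B$ of $\{X,Y\}\cup AA(\{X,Y\})\cup\{z_1,\dots,z_{i-1}\}$ with $\{A,B\}\neq\{X,Y\}$. -/

import Mathlib

/-- A mixed graph with at most one edge between each pair of nodes and no loops: a skeleton together
with the arrowheads. `head u v` means that the edge between `u` and `v` has an arrowhead at `v`;
an end of an edge without an arrowhead carries a tail. -/
structure MixedGraph (V : Type*) where
  skel : SimpleGraph V
  head : V → V → Prop
  adj_of_head : ∀ {u v : V}, head u v → skel.Adj u v

namespace MixedGraph

variable {V : Type*} (G : MixedGraph V)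

/-- The directed edge `u → v`. -/
def Directed (u v : V) : Prop := G.head u v ∧ ¬ G.head v u

/-- The undirected edge `u - v`. -/
def Undirected (u v : V) : Prop := G.skel.Adj u v ∧ ¬ G.head u v ∧ ¬ G.head v u

/-- `u` is an ancestor of `v`: there is a directed path from `u` to `v`, or `u = v`. -/
def Ancestor (u v : V) : Prop := Relation.ReflTransGen G.Directed u v

/-- `u` is anterior to `v`: there is a path `u - ... - w → ... → v`, whose undirected part and
whose directed part may each be empty. -/
def Anterior (u v : V) : Prop :=
  ∃ w, Relation.ReflTransGen G.Undirected u w ∧ G.Ancestor w v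

/-- The nodes adjacent to some node of `S`. -/
def adjSet (S : Set V) : Set V := {v | ∃ s ∈ S, G.skel.Adj v s}

/-- The nodes anterior to some node of `S`. -/
def antSet (S : Set V) : Set V := {v | ∃ s ∈ S, G.Anterior v s}

/-- The adjacent anteriors `AA(S)`. -/
def adjAnt (S : Set V) : Set V := (G.adjSet S ∩ G.antSet S) \ S

/-- The path `p` is unblocked relative to `Z`: for consecutive nodes `a, b, c` of `p`, if `b` is a
collider then it is an ancestor of some node of `Z`, and if `b` is a noncollider then it is
not in `Z`. -/
def Unblocked {x y : V} (p : G.skel.Path x y) (Z : Set V) : Prop :=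
  ∀ i : ℕ, i + 2 ≤ p.1.length →
    ((G.head (p.1.getVert i) (p.1.getVert (i + 1)) ∧
        G.head (p.1.getVert (i + 2)) (p.1.getVert (i + 1))) →
      ∃ z ∈ Z, G.Ancestor (p.1.getVert (i + 1)) z) ∧
    (¬ (G.head (p.1.getVert i) (p.1.getVert (i + 1)) ∧
        G.head (p.1.getVert (i + 2)) (p.1.getVert (i + 1))) →
      p.1.getVert (i + 1) ∉ Z)

/-- `x` and `y` are connected (dependent) given `Z`. -/
def Connected (x y : V) (Z : Set V) : Prop := ∃ p : G.skel.Path x y, G.Unblocked p Z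

/-- `Z` separates the distinct nodes `x` and `y`, neither of which is in `Z`. -/
def Separates (x y : V) (Z : Set V) : Prop :=
  x ≠ y ∧ x ∉ Z ∧ y ∉ Z ∧ ¬ G.Connected x y Z

/-- `Z` is a minimal separating set between `x` and `y`. -/
def MinSeparates (x y : V) (Z : Set V) : Prop :=
  G.Separates x y Z ∧ ∀ Z' : Set V, Z' ⊂ Z → G.Connected x y Z'

/-- `C ∪ Z` separates `x` and `y`, where `Z` is minimal for the given `C`. -/
def MinSeparatesGiven (x y : V) (C Z : Set V) : Prop :=
  G.Separates x y (C ∪ Z) ∧ ∀ Z' : Set V, Z' ⊂ Z → G.Connected x y (C ∪ Z')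

/-- Ancestral graphs: an arrowhead at `v` on an edge to `u` implies that there is no directed path
from `v` to `u`, and there are no arrowheads at nodes with undirected edges. -/
def IsAncestral : Prop :=
  ∀ u v : V, G.head u v → ¬ G.Ancestor v u ∧ ∀ w, ¬ G.Undirected v w

/-- Maximal ancestral graphs: any two distinct nonadjacent nodes can be separated. -/
def IsMAG : Prop :=
  G.IsAncestral ∧ ∀ u v : V, u ≠ v → ¬ G.skel.Adj u v → ∃ Z : Set V, G.Separates u v Z

/-- `x` and `y` are D-separated by `Z`. -/
def DSeparates (x y : V) (Z : Set V) : Prop :=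
  G.Separates x y Z ∧ ∀ Z' : Set V, Z' ⊆ G.adjSet {x, y} \ {x, y} → G.Connected x y Z'

/-- `(x, y)` is a D-sep link. -/
def IsDSepLink (x y : V) : Prop := ∃ Z : Set V, G.DSeparates x y Z

/-- `z` is a D-sep node for `(x, y)` in the D-separating set `Z`. -/
def IsDSepNode (x y : V) (Z : Set V) (z : V) : Prop :=
  G.DSeparates x y Z ∧ z ∈ Z ∧ z ∉ G.adjSet {x, y} ∧
    ∀ Z' : Set V, Z' ⊆ G.adjSet {x, y} → G.Connected x y ((Z \ {z}) ∪ Z')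

end MixedGraph

/-!
The proof works with walks instead of paths. A walk is open relative to `Z` if its colliders are
ancestors of `Z` and its noncolliders are outside `Z`; cutting out closed parts turns an open walk
into an unblocked path (`TripleWalk.connected`). Two facts about separation in ancestral graphs
follow. A collider may as well be an ancestor of an end of the walk
(`TripleWalk.connected_of_ancSet_ends`), and all nodes of an open walk are anterior to its ends or
to `Z` (`TripleWalk.inner_anterior`). Hence separation of `a` and `b` by sets of anteriors of `a` and
`b` is monotone in the set (`Connected.anti`), and nodes that are not anterior are useless for it
(`Connected.of_subset`). So `ZDS` consists of anteriors of `X` and `Y`, none of which is adjacent to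
`X` or `Y` as it would be in `AA`, and adding further adjacent nodes does not make up for the loss of
a node of `ZDS`. This gives the statement on D-sep nodes.

For the enumeration, let `T` be a proper subset of `ZDS` and `C = AA ∪ T`, so that `X` and `Y` are
connected given `C`. Suppose that no node of `ZDS \ T` is in a minimal separating set of a pair
in `{X, Y} ∪ C` other than `{X, Y}`. By monotonicity, if such a pair is connected given nodes of `C`
that are anterior to it, then it remains so after adding the nodes of `ZDS` that are anterior to it.
Consider the graph on `{X, Y} ∪ C` that links two such nodes `a`, `b` if a walk with noncolliders
outside `C` and with colliders among the ancestors of `a` and `b` arrives at both with arrowheads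
(`linkGraph`; no condition on the arrival at `X` and `Y`). An unblocked path given `C`, cut at its
colliders, gives a path from `X` to `Y` in this graph; take a shortest one. Each of its edges may be
replaced by a walk that is open relative to `AA ∪ ZDS`. If such a walk leaves an inner node `b` with
a tail, then `b` is an ancestor of its neighbour, and the two edges at `b` could be merged into one
(`linkGraph_adj_of_ancestor`). The merged pair is not `{X, Y}`, since then `b` would be an
ancestor of, say, `Y`, and the last node before `Y` on the walk from `b` would be in `AA`, so a
collider, and an ancestor of `Y` with an arrowhead on its edge to `Y`. Hence the walks meet in
colliders in `C`, and together they connect `X` and `Y` given `AA ∪ ZDS`: a contradiction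
(`Connected.of_forall_pair`).
-/

namespace MixedGraph

variable {V : Type*} {G : MixedGraph V}

/-! ### Ancestors and anteriors -/

/-- The nodes that are ancestors of some node of `S`. -/
def ancSet (G : MixedGraph V) (S : Set V) : Set V := {v | ∃ s ∈ S, G.Ancestor v s}

theorem Ancestor.trans {u v w : V} (h : G.Ancestor u v) (h' : G.Ancestor v w) : G.Ancestor u w :=
  Relation.ReflTransGen.trans h h'

theorem Ancestor.refl (u : V) : G.Ancestor u u := Relation.ReflTransGen.refl

theorem Directed.adj {u v : V} (h : G.Directed u v) : G.skel.Adj u v := G.adj_of_head h.1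

theorem Directed.ancestor {u v : V} (h : G.Directed u v) : G.Ancestor u v :=
  Relation.ReflTransGen.single h

theorem Ancestor.anterior {u v : V} (h : G.Ancestor u v) : G.Anterior u v :=
  ⟨u, Relation.ReflTransGen.refl, h⟩

theorem subset_ancSet (S : Set V) : S ⊆ G.ancSet S := fun v hv => ⟨v, hv, Ancestor.refl v⟩

theorem ancSet_mono {S T : Set V} (h : S ⊆ T) : G.ancSet S ⊆ G.ancSet T :=
  fun _ ⟨s, hs, hv⟩ => ⟨s, h hs, hv⟩

theorem mem_ancSet_of_ancestor {S : Set V} {u v : V} (h : G.Ancestor u v) (hv : v ∈ G.ancSet S) :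
    u ∈ G.ancSet S :=
  let ⟨s, hs, hvs⟩ := hv
  ⟨s, hs, h.trans hvs⟩

theorem subset_antSet (S : Set V) : S ⊆ G.antSet S :=
  fun v hv => ⟨v, hv, (Ancestor.refl v).anterior⟩

/-- An edge with a tail at a node that carries an arrowhead is directed out of that node. -/
theorem IsAncestral.directed_of_head (hG : G.IsAncestral) {a b c : V} (hab : G.head a b)
    (hbc : G.skel.Adj b c) (hcb : ¬ G.head c b) : G.Directed b c := by
  refine ⟨?_, hcb⟩
  by_contra h
  exact (hG a b hab).2 c ⟨hbc, h, hcb⟩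

theorem IsAncestral.ancestor_of_anterior (hG : G.IsAncestral) {a b c : V} (hab : G.head a b)
    (h : G.Anterior b c) : G.Ancestor b c := by
  obtain ⟨w, hu, hd⟩ := h
  rcases Relation.ReflTransGen.cases_head hu with rfl | ⟨x, hx, -⟩
  · exact hd
  · exact absurd hx ((hG a b hab).2 x)

theorem IsAncestral.anterior_of_ancestor_of_anterior (hG : G.IsAncestral) {a b c : V}
    (hab : G.Ancestor a b) (h : G.Anterior b c) : G.Anterior a c := by
  rcases Relation.ReflTransGen.cases_tail hab with rfl | ⟨x, -, hx⟩
  · exact h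
  · exact (Ancestor.trans hab (hG.ancestor_of_anterior hx.1 h)).anterior

theorem IsAncestral.anterior_trans (hG : G.IsAncestral) {a b c : V}
    (hab : G.Anterior a b) (h : G.Anterior b c) : G.Anterior a c := by
  obtain ⟨w, hu, hd⟩ := hab
  obtain ⟨x, hx, hxc⟩ := hG.anterior_of_ancestor_of_anterior hd h
  exact ⟨x, hu.trans hx, hxc⟩

theorem IsAncestral.antSet_subset (hG : G.IsAncestral) {S T : Set V} (h : S ⊆ G.antSet T) :
    G.antSet S ⊆ G.antSet T := by
  rintro v ⟨s, hs, hvs⟩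
  obtain ⟨t, ht, hst⟩ := h hs
  exact ⟨t, ht, hG.anterior_trans hvs hst⟩

theorem ancSet_subset_antSet (S : Set V) : G.ancSet S ⊆ G.antSet S :=
  fun _ ⟨s, hs, hv⟩ => ⟨s, hs, hv.anterior⟩

theorem IsAncestral.mem_ancSet_of_mem_antSet (hG : G.IsAncestral) {S : Set V} {a b : V}
    (hab : G.head a b) (h : b ∈ G.antSet S) : b ∈ G.ancSet S :=
  let ⟨s, hs, hb⟩ := h
  ⟨s, hs, hG.ancestor_of_anterior hab hb⟩

/-! ### Walks with constrained triples -/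

/-- There is a walk in `G` with first edge `a, b` and last edge `c, d` all of whose triples of
consecutive nodes satisfy `ok`. The second and the penultimate node are recorded because the marks
at the two ends decide whether the ends become colliders when walks are concatenated. -/
inductive TripleWalk (G : MixedGraph V) (ok : V → V → V → Prop) : V → V → V → V → Prop
  | edge {a b : V} : G.skel.Adj a b → TripleWalk G ok a b a b
  | cons {a b c d e : V} : G.skel.Adj a b → ok a b c → TripleWalk G ok b c d e →
      TripleWalk G ok a b d e

namespace TripleWalk

variable {ok ok' : V → V → V → Prop} {a b c d e f g : V}

theorem adj_first (h : G.TripleWalk ok a b c d) : G.skel.Adj a b := by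
  cases h <;> assumption

theorem append (h : G.TripleWalk ok a b c d) (hm : ok c d e) (h' : G.TripleWalk ok d e f g) :
    G.TripleWalk ok a b f g := by
  induction h with
  | edge h => exact cons h hm h'
  | cons h h1 _ ih => exact cons h h1 (ih hm h')

theorem reverse (hs : ∀ x y z, ok x y z → ok' z y x) (h : G.TripleWalk ok a b c d) :
    G.TripleWalk ok' d c b a := by
  induction h with
  | edge h => exact edge h.symm
  | cons h h1 _ ih => exact ih.append (hs _ _ _ h1) (edge h.symm)

theorem adj_last (h : G.TripleWalk ok a b c d) : G.skel.Adj c d := by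
  induction h <;> assumption

theorem mono (hs : ∀ x y z, ok x y z → ok' x y z) (h : G.TripleWalk ok a b c d) :
    G.TripleWalk ok' a b c d := by
  induction h with
  | edge h => exact edge h
  | cons h h1 _ ih => exact cons h (hs _ _ _ h1) ih

/-- To strengthen the constraint on triples, one may use the two parts into which a triple
divides the walk. -/
theorem strengthen (h : G.TripleWalk ok a b c d)
    (hs : ∀ x y z, G.TripleWalk ok a b x y → ok x y z → G.TripleWalk ok y z c d → ok' x y z) :
    G.TripleWalk ok' a b c d := by
  induction h with
  | edge h => exact edge h
  | cons h h1 h2 ih =>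
    exact cons h (hs _ _ _ (edge h) h1 h2)
      (ih fun x y z hx hy hz => hs x y z (cons h h1 hx) hy hz)

theorem cases_last (h : G.TripleWalk ok a b c d) :
    (c = a ∧ d = b) ∨ ∃ e, G.TripleWalk ok a b e c ∧ ok e c d := by
  induction h with
  | edge h => exact Or.inl ⟨rfl, rfl⟩
  | cons h h1 _ ih =>
    rcases ih with ⟨rfl, rfl⟩ | ⟨e, he, hok⟩
    · exact Or.inr ⟨_, edge h, h1⟩
    · exact Or.inr ⟨e, cons h h1 he, hok⟩

end TripleWalk

/-- The condition of being unblocked at the middle node `b` of `a, b, c`: a collider lies in `D`, a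
noncollider lies outside `Z`. -/
def Allowed (G : MixedGraph V) (D Z : Set V) (a b c : V) : Prop :=
  (G.head a b ∧ G.head c b → b ∈ D) ∧ (¬ (G.head a b ∧ G.head c b) → b ∉ Z)

theorem Allowed.symm {D Z : Set V} {a b c : V} (h : G.Allowed D Z a b c) : G.Allowed D Z c b a := by
  unfold Allowed at *
  rwa [and_comm (a := G.head c b)]

theorem Allowed.mono {D D' Z Z' : Set V} (hD : D ⊆ D') (hZ : Z' ⊆ Z) {a b c : V}
    (h : G.Allowed D Z a b c) : G.Allowed D' Z' a b c :=
  ⟨fun hc => hD (h.1 hc), fun hc hb => h.2 hc (hZ hb)⟩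

theorem allowed_of_tail {D Z : Set V} {a b c : V} (h : ¬ G.head a b) (hb : b ∉ Z) :
    G.Allowed D Z a b c :=
  ⟨fun hc => absurd hc.1 h, fun _ => hb⟩

theorem allowed_of_collider {D Z : Set V} {a b c : V} (h : G.head a b) (h' : G.head c b)
    (hb : b ∈ D) : G.Allowed D Z a b c :=
  ⟨fun _ => hb, fun hc => absurd ⟨h, h'⟩ hc⟩

/-- Following a walk that leaves its first node by a directed edge, one reaches a collider or the
last node along directed edges. -/
theorem TripleWalk.second_ancestor (hG : G.IsAncestral) {D Z : Set V} {a b c d : V}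
    (h : G.TripleWalk (G.Allowed D Z) a b c d) (hab : G.head a b) :
    b ∈ G.ancSet (insert d D) := by
  induction h with
  | edge h => exact ⟨_, Set.mem_insert _ _, Ancestor.refl _⟩
  | @cons a b c d e h h1 h2 ih =>
    by_cases hc : G.head c b
    · exact ⟨b, Or.inr (h1.1 ⟨hab, hc⟩), Ancestor.refl _⟩
    · have := hG.directed_of_head hab h2.adj_first hc
      exact mem_ancSet_of_ancestor this.ancestor (ih this.1)

/-- A node at which a walk starts with a tail is anterior to a collider or to the last node. -/
theorem TripleWalk.first_anterior (hG : G.IsAncestral) {D Z : Set V} {a b c d : V}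
    (h : G.TripleWalk (G.Allowed D Z) a b c d) (hba : ¬ G.head b a) :
    a ∈ G.antSet (insert d D) := by
  induction h with
  | @edge a b h =>
    refine ⟨b, Set.mem_insert _ _, ?_⟩
    by_cases hab : G.head a b
    · exact (Directed.ancestor ⟨hab, hba⟩).anterior
    · exact ⟨b, .single ⟨h, hab, hba⟩, Ancestor.refl _⟩
  | @cons a b c d e h h1 h2 ih =>
    by_cases hab : G.head a b
    · obtain ⟨s, hs, hbs⟩ := (TripleWalk.cons h h1 h2).second_ancestor hG hab
      exact ⟨s, hs, (Ancestor.trans (Directed.ancestor ⟨hab, hba⟩) hbs).anterior⟩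
    · have hc : ¬ G.head c b := fun hc => (hG c b hc).2 a ⟨h.symm, hba, hab⟩
      obtain ⟨s, hs, w, hw, hws⟩ := ih hc
      exact ⟨s, hs, w, hw.head ⟨h, hab, hba⟩, hws⟩

/-- All inner nodes of a walk are anterior to its ends or to its colliders. -/
theorem TripleWalk.inner_anterior (hG : G.IsAncestral) {D Z : Set V} {ok : V → V → V → Prop}
    (hok : ∀ x y z, ok x y z → G.Allowed D Z x y z) {a b c d : V}
    (h : G.TripleWalk ok a b c d) :
    G.TripleWalk (fun x y z => ok x y z ∧ y ∈ G.antSet ({a, d} ∪ D)) a b c d := by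
  refine h.strengthen fun x y z h1 hy h2 => ⟨hy, ?_⟩
  by_cases hx : G.head x y
  · by_cases hz : G.head z y
    · exact subset_antSet _ (Or.inr ((hok _ _ _ hy).1 ⟨hx, hz⟩))
    · obtain ⟨s, rfl | hs, hys⟩ := (h2.mono hok).first_anterior hG hz
      exacts [⟨_, Or.inl (Or.inr rfl), hys⟩, ⟨s, Or.inr hs, hys⟩]
  · obtain ⟨s, rfl | hs, hys⟩ :=
      (h1.reverse fun _ _ _ h => (hok _ _ _ h).symm).first_anterior hG hx
    exacts [⟨_, Or.inl (Or.inl rfl), hys⟩, ⟨s, Or.inr hs, hys⟩]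

/-! ### Walks and paths -/

/-- A walk that is unblocked relative to `Z`, given by an enumeration of its nodes;
only the values up to `n` matter. -/
def IsOpenSeq (G : MixedGraph V) (Z : Set V) (n : ℕ) (w : ℕ → V) : Prop :=
  (∀ i < n, G.skel.Adj (w i) (w (i + 1))) ∧
    ∀ i, i + 2 ≤ n → G.Allowed (G.ancSet Z) Z (w i) (w (i + 1)) (w (i + 2))

theorem TripleWalk.exists_isOpenSeq {Z : Set V} {a b c d : V}
    (h : G.TripleWalk (G.Allowed (G.ancSet Z) Z) a b c d) :
    ∃ (n : ℕ) (w : ℕ → V), w 0 = a ∧ w 1 = b ∧ w n = d ∧ G.IsOpenSeq Z n w := by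
  induction h with
  | @edge a b h =>
    refine ⟨1, fun i => if i = 0 then a else b, by simp, by simp, by simp, ?_, ?_⟩
    · intro i hi
      obtain rfl : i = 0 := by omega
      simpa using h
    · intro i hi
      omega
  | @cons a b c d e h h1 _ ih =>
    obtain ⟨n, w, h0, hw1, hn, hadj, hok⟩ := ih
    refine ⟨n + 1, fun i => Nat.casesOn i a w, rfl, h0, hn, ?_, ?_⟩
    · rintro (_ | i) hi
      · simpa [h0] using h
      · exact hadj i (by omega)
    · rintro (_ | i) hi
      · simpa [h0, hw1] using h1
      · exact hok i (by omega)

/-- An open walk that leaves `w i` by a directed edge and returns to it passes through a collider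
that is a descendant of `w i`. -/
theorem IsOpenSeq.mem_ancSet_of_eq (hG : G.IsAncestral) {Z : Set V} {n : ℕ} {w : ℕ → V}
    (h : G.IsOpenSeq Z n w) {i j : ℕ} (hij : i < j) (hj : j ≤ n) (heq : w i = w j)
    (hi : G.Directed (w i) (w (i + 1))) : w i ∈ G.ancSet Z := by
  by_contra hcon
  have key : ∀ k, i + 1 + k ≤ j → G.Ancestor (w (i + 1)) (w (i + 1 + k)) ∧
      G.Directed (w (i + k)) (w (i + 1 + k)) := by
    intro k
    induction k with
    | zero => exact fun _ => ⟨Ancestor.refl _, hi⟩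
    | succ k ih =>
      intro hk
      obtain ⟨h1, h2⟩ := ih (by omega)
      have hok := h.2 (i + k) (by omega)
      rw [show i + k + 1 = i + 1 + k by omega, show i + k + 2 = i + 1 + (k + 1) by omega] at hok
      have hadj := h.1 (i + 1 + k) (by omega)
      rw [show i + 1 + k + 1 = i + 1 + (k + 1) by omega] at hadj
      by_cases hc : G.head (w (i + 1 + (k + 1))) (w (i + 1 + k))
      · exact absurd (mem_ancSet_of_ancestor (hi.ancestor.trans h1) (hok.1 ⟨h2.1, hc⟩)) hcon
      · have := hG.directed_of_head h2.1 hadj hc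
        refine ⟨h1.trans this.ancestor, ?_⟩
        rwa [show i + (k + 1) = i + 1 + k by omega]
  have := (key (j - (i + 1)) (by omega)).1
  rw [show i + 1 + (j - (i + 1)) = j by omega, ← heq] at this
  exact (hG _ _ hi.1).1 this

/-- Cutting a closed part out of an open walk leaves an open walk. -/
theorem IsOpenSeq.exists_shorter (hG : G.IsAncestral) {Z : Set V} {n : ℕ} {w : ℕ → V}
    (h : G.IsOpenSeq Z n w) {i j : ℕ} (hij : i < j) (hj : j ≤ n) (heq : w i = w j) :
    ∃ (m : ℕ) (w' : ℕ → V), m < n ∧ w' 0 = w 0 ∧ w' m = w n ∧ G.IsOpenSeq Z m w' := by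
  obtain ⟨δ, rfl⟩ : ∃ δ, j = i + δ := ⟨j - i, by omega⟩
  obtain ⟨m, rfl⟩ : ∃ m, n = m + δ := ⟨n - δ, by omega⟩
  set w' : ℕ → V := fun k => if k ≤ i then w k else w (k + δ) with hw'
  have lo : ∀ k ≤ i, w' k = w k := fun k hk => if_pos hk
  have hi : ∀ k, i ≤ k → w' k = w (k + δ) := by
    intro k hk
    rcases hk.eq_or_lt with rfl | hk
    · rw [lo _ le_rfl, heq]
    · exact if_neg (by omega)
  refine ⟨m, w', by omega, lo 0 (by omega), hi m (by omega), ?_, ?_⟩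
  · intro k hk
    by_cases hki : k + 1 ≤ i
    · rw [lo k (by omega), lo _ hki]
      exact h.1 k (by omega)
    · rw [hi k (by omega), hi (k + 1) (by omega), show k + 1 + δ = k + δ + 1 by omega]
      exact h.1 (k + δ) (by omega)
  · intro k hk
    rcases lt_trichotomy (k + 1) i with hki | rfl | hki
    · rw [lo k (by omega), lo (k + 1) (by omega), lo (k + 2) (by omega)]
      exact h.2 k (by omega)
    · rw [lo k (by omega), lo (k + 1) (by omega), hi (k + 2) (by omega)]
      have ok1 := h.2 k (by omega)
      have ok2 := h.2 (k + δ) (by omega)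
      rw [show k + δ + 1 = k + 1 + δ by omega, ← heq,
        show k + δ + 2 = k + 2 + δ by omega] at ok2
      constructor
      · rintro ⟨c1, c2⟩
        by_cases hc : G.head (w (k + 2)) (w (k + 1))
        · exact ok1.1 ⟨c1, hc⟩
        · exact h.mem_ancSet_of_eq hG hij hj heq
            (hG.directed_of_head c1 (h.1 (k + 1) (by omega)) hc)
      · intro hnc
        by_cases c1 : G.head (w k) (w (k + 1))
        · exact ok2.2 fun hc => hnc ⟨c1, hc.2⟩
        · exact ok1.2 fun hc => c1 hc.1
    · rw [hi k (by omega), hi (k + 1) (by omega), hi (k + 2) (by omega),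
        show k + 1 + δ = k + δ + 1 by omega, show k + 2 + δ = k + δ + 2 by omega]
      exact h.2 (k + δ) (by omega)

/-- A sequence of consecutively adjacent nodes is the node sequence of a walk. -/
theorem exists_walk_getVert_eq {H : SimpleGraph V} (n : ℕ) :
    ∀ w : ℕ → V, (∀ i < n, H.Adj (w i) (w (i + 1))) →
      ∃ p : H.Walk (w 0) (w n), p.length = n ∧ ∀ i ≤ n, p.getVert i = w i := by
  induction n with
  | zero =>
    intro w _
    exact ⟨.nil, rfl, fun i hi => by obtain rfl : i = 0 := by omega
                                     rfl⟩
  | succ n ih =>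
    intro w hw
    obtain ⟨p, hp, hv⟩ := ih (fun i => w (i + 1)) fun i hi => hw (i + 1) (by omega)
    refine ⟨.cons (hw 0 (by omega)) p, by simp [hp], ?_⟩
    rintro (_ | i) hi
    · rfl
    · simpa using hv i (by omega)

/-- An open walk can be shortened to an unblocked path. -/
theorem TripleWalk.connected (hG : G.IsAncestral) {Z : Set V} {a b c d : V}
    (h : G.TripleWalk (G.Allowed (G.ancSet Z) Z) a b c d) : G.Connected a d Z := by
  classical
  have hex : ∃ n, ∃ w : ℕ → V, w 0 = a ∧ w n = d ∧ G.IsOpenSeq Z n w :=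
    let ⟨n, w, h0, _, hn, hw⟩ := h.exists_isOpenSeq
    ⟨n, w, h0, hn, hw⟩
  obtain ⟨w, h0, hn, hw⟩ := Nat.find_spec hex
  have hmin := fun m (hm : m < Nat.find hex) => Nat.find_min hex hm
  generalize Nat.find hex = n at *
  have inj : ∀ i j, i < j → j ≤ n → w i ≠ w j := by
    intro i j hij hj heq
    obtain ⟨m, w', hm, h0', hm', hw'⟩ := hw.exists_shorter hG hij hj heq
    exact hmin m hm ⟨w', h0'.trans h0, hm'.trans hn, hw'⟩
  subst h0 hn
  obtain ⟨p, hp, hv⟩ := exists_walk_getVert_eq n w hw.1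
  have hpath : p.IsPath := by
    rw [← SimpleGraph.Walk.IsPath.getVert_injOn_iff]
    intro i hi j hj hij
    simp only [Set.mem_ofPred_eq, hp] at hi hj
    rw [hv i hi, hv j hj] at hij
    by_contra hne
    rcases Nat.lt_or_gt_of_ne hne with hlt | hlt
    exacts [inj i j hlt hj hij, inj j i hlt hi hij.symm]
  refine ⟨⟨p, hpath⟩, fun i hi => ?_⟩
  rw [hv i (by simp at hi; omega), hv (i + 1) (by simp at hi; omega),
    hv (i + 2) (by simp at hi; omega)]
  exact hw.2 i (by simp at hi; omega)

theorem TripleWalk.of_seq {ok : V → V → V → Prop} (n : ℕ) :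
    ∀ w : ℕ → V, (∀ i < n + 1, G.skel.Adj (w i) (w (i + 1))) →
      (∀ i, i + 2 ≤ n + 1 → ok (w i) (w (i + 1)) (w (i + 2))) →
      G.TripleWalk ok (w 0) (w 1) (w n) (w (n + 1)) := by
  induction n with
  | zero => exact fun w h _ => .edge (h 0 (by omega))
  | succ n ih =>
    exact fun w h h' => .cons (h 0 (by omega)) (h' 0 (by omega))
      (ih (fun i => w (i + 1)) (fun i hi => h (i + 1) (by omega))
        fun i hi => h' (i + 1) (by omega))

/-- An unblocked path is an open walk that does not return to its ends. -/
theorem Connected.exists_tripleWalk {Z : Set V} {a d : V} (had : a ≠ d) (h : G.Connected a d Z) :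
    ∃ b c, G.TripleWalk
      (fun x y z => G.Allowed (G.ancSet Z) Z x y z ∧ y ≠ a ∧ y ≠ d) a b c d := by
  obtain ⟨⟨p, hp⟩, hop⟩ := h
  obtain ⟨n, hn⟩ : ∃ n, p.length = n + 1 := by
    refine Nat.exists_eq_succ_of_ne_zero fun h0 => had (SimpleGraph.Walk.eq_of_length_eq_zero h0)
  have key := TripleWalk.of_seq (G := G)
    (ok := fun x y z => G.Allowed (G.ancSet Z) Z x y z ∧ y ≠ a ∧ y ≠ d) n p.getVert
    (fun i hi => p.adj_getVert_succ (by omega)) fun i hi => ⟨hop i (hn ▸ hi), ?_, ?_⟩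
  · rw [p.getVert_zero, ← hn, p.getVert_length] at key
    exact ⟨_, _, key⟩
  · rw [Ne, hp.getVert_eq_start_iff (by omega)]
    omega
  · rw [Ne, hp.getVert_eq_end_iff (by omega)]
    omega

/-! ### Separation by sets of anteriors -/

/-- A directed path, stopped at its first node in `Z`, as a walk. -/
theorem Ancestor.exists_tripleWalk (Z : Set V) {a d : V} (h : G.Ancestor a d) :
    ∃ e, (e = d ∨ e ∈ Z) ∧ G.Ancestor a e ∧ (a = e ∨ a ∉ Z ∧ ∃ b c,
      G.TripleWalk (G.Allowed ∅ Z) a b c e ∧ G.Directed a b ∧ G.Directed c e) := by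
  induction h using Relation.ReflTransGen.head_induction_on with
  | refl => exact ⟨d, Or.inl rfl, .refl _, Or.inl rfl⟩
  | @head a x hax _ ih =>
    by_cases ha : a ∈ Z
    · exact ⟨a, Or.inr ha, .refl _, Or.inl rfl⟩
    · obtain ⟨e, he, hxe, rfl | ⟨hx, b, c, hw, hb, hc⟩⟩ := ih
      · exact ⟨_, he, hax.ancestor, Or.inr ⟨ha, _, _, .edge hax.adj, hax, hax⟩⟩
      · exact ⟨e, he, hax.ancestor.trans hxe, Or.inr ⟨ha, x, c,
          .cons hax.adj (allowed_of_tail hb.2 hx).symm hw, hax, hc⟩⟩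

/-- Colliders that are ancestors of `a` can be avoided by walks that start at `a`: from the last such
collider, a directed path leads to `a`. -/
theorem TripleWalk.bypass {D Z : Set V} (hD : G.ancSet Z ⊆ D) {a x y c d : V}
    (h : G.TripleWalk (G.Allowed (D ∪ G.ancSet {a}) Z) x y c d) :
    G.TripleWalk (G.Allowed D Z) x y c d ∨
      ∃ b' c', G.TripleWalk (G.Allowed D Z) a b' c' d := by
  induction h with
  | edge h => exact Or.inl (edge h)
  | @cons x y c d e h hok h2 ih =>
    rcases ih with ih | ih
    · by_cases hg : G.Allowed D Z x y c
      · exact Or.inl (cons h hg ih)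
      · right
        have hyD : y ∉ D := fun hy => hg ⟨fun _ => hy, hok.2⟩
        have hya : G.Ancestor y a := by
          by_contra hya
          refine hg ⟨fun hc => ?_, hok.2⟩
          rcases hok.1 hc with h | ⟨s, rfl, hs⟩
          exacts [h, absurd hs hya]
        obtain ⟨e, he, hye, h⟩ := hya.exists_tripleWalk Z
        have heZ : e ∉ Z := fun heZ => hyD (hD ⟨e, heZ, hye⟩)
        obtain rfl : e = a := he.resolve_right heZ
        rcases h with rfl | ⟨hyZ, p, q, hw, hp, -⟩
        · exact ⟨_, _, ih⟩
        · refine ⟨_, _, TripleWalk.append (hw.reverse fun _ _ _ h => ?_)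
            (allowed_of_tail hp.2 hyZ) ih⟩
          exact (h.mono (Set.empty_subset _) subset_rfl).symm
    · exact Or.inr ih

/-- For the existence of an unblocked path it is enough to have a walk whose colliders are
ancestors of `Z` or of its ends. -/
theorem TripleWalk.connected_of_ancSet_ends (hG : G.IsAncestral) {D Z : Set V} {a b c d : V}
    (h : G.TripleWalk (G.Allowed D Z) a b c d)
    (hD : D ⊆ G.ancSet Z ∪ G.ancSet {d} ∪ G.ancSet {a}) : G.Connected a d Z := by
  obtain ⟨b, c, h1⟩ : ∃ b c,
      G.TripleWalk (G.Allowed (G.ancSet Z ∪ G.ancSet {d}) Z) a b c d := by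
    rcases (h.mono fun _ _ _ h => h.mono hD subset_rfl).bypass Set.subset_union_left with h | h
    exacts [⟨_, _, h⟩, h]
  obtain ⟨b, c, h2⟩ : ∃ b c, G.TripleWalk (G.Allowed (G.ancSet Z) Z) d b c a := by
    rcases (h1.reverse fun _ _ _ => Allowed.symm).bypass subset_rfl with h | h
    exacts [⟨_, _, h⟩, h]
  exact (h2.reverse fun _ _ _ => Allowed.symm).connected hG

theorem IsAncestral.antSet_union_subset (hG : G.IsAncestral) {S T : Set V}
    (h : T ⊆ G.antSet S) : G.antSet (S ∪ G.ancSet T) ⊆ G.antSet S :=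
  hG.antSet_subset (Set.union_subset (subset_antSet S)
    ((ancSet_subset_antSet T).trans (hG.antSet_subset h)))

/-- Among sets of anteriors of the ends, supersets of separating sets are separating. -/
theorem Connected.anti (hG : G.IsAncestral) {a d : V} {Z W : Set V}
    (hZ : Z ⊆ G.antSet {a, d}) (hWZ : W ⊆ Z) (had : a ≠ d) (h : G.Connected a d Z) :
    G.Connected a d W := by
  obtain ⟨b, c, h⟩ := h.exists_tripleWalk had
  refine TripleWalk.connected_of_ancSet_ends hG (D := G.ancSet {a, d}) (h.mono ?_) ?_
  · rintro x y z ⟨hok, -⟩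
    refine ⟨fun hc => ?_, fun hc hy => hok.2 hc (hWZ hy)⟩
    exact hG.mem_ancSet_of_mem_antSet hc.1
      (hG.antSet_subset hZ (ancSet_subset_antSet _ (hok.1 hc)))
  · rintro v ⟨s, rfl | rfl, hv⟩
    exacts [Or.inr ⟨_, rfl, hv⟩, Or.inl (Or.inr ⟨_, rfl, hv⟩)]

/-- A path that is unblocked relative to a set of anteriors of its ends consists of anteriors. -/
theorem Connected.exists_tripleWalk_anterior (hG : G.IsAncestral) {a d : V} {Z : Set V}
    (hZ : Z ⊆ G.antSet {a, d}) (had : a ≠ d) (h : G.Connected a d Z) :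
    ∃ b c, G.TripleWalk (fun x y z => (G.Allowed (G.ancSet Z) Z x y z ∧ y ≠ a ∧ y ≠ d) ∧
      y ∈ G.antSet {a, d}) a b c d := by
  obtain ⟨b, c, h⟩ := h.exists_tripleWalk had
  exact ⟨b, c, (h.inner_anterior hG fun _ _ _ h => h.1).mono fun _ _ _ h =>
    ⟨h.1, hG.antSet_union_subset hZ h.2⟩⟩

/-- Nodes that are not anterior to the ends do not block paths that are unblocked relative to a
set of anteriors of the ends. -/
theorem Connected.of_subset (hG : G.IsAncestral) {a d : V} {Z W : Set V}
    (hZ : Z ⊆ G.antSet {a, d}) (had : a ≠ d) (hZW : Z ⊆ W)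
    (hW : ∀ u ∈ W, u ∈ G.antSet {a, d} → u ≠ a → u ≠ d → u ∈ Z) (h : G.Connected a d Z) :
    G.Connected a d W := by
  obtain ⟨b, c, h⟩ := h.exists_tripleWalk_anterior hG hZ had
  refine TripleWalk.connected hG (b := b) (c := c) (h.mono ?_)
  rintro x y z ⟨⟨hok, hya, hyd⟩, hy⟩
  exact ⟨fun hc => ancSet_mono hZW (hok.1 hc), fun hc hyW => hok.2 hc (hW y hyW hy hya hyd)⟩

theorem Separates.exists_minSeparates [Finite V] {a d : V} {Z : Set V} (h : G.Separates a d Z) :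
    ∃ W ⊆ Z, G.MinSeparates a d W := by
  obtain ⟨W, hWZ, hW⟩ := exists_minimal_le_of_wellFoundedLT (G.Separates a d) Z h
  refine ⟨W, hWZ, hW.prop, fun W' hW' => ?_⟩
  by_contra hcon
  exact hW.not_prop_of_lt hW' ⟨hW.prop.1, fun h => hW.prop.2.1 (hW'.subset h),
    fun h => hW.prop.2.2.1 (hW'.subset h), hcon⟩

/-- If adding anteriors `N` of the ends to `Z` makes a difference, then a minimal separating
set contains a node of `N`. -/
theorem exists_minSeparates_of_not_connected [Finite V] (hG : G.IsAncestral) {a d : V}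
    {Z N : Set V} (hZ : Z ⊆ G.antSet {a, d}) (had : a ≠ d) (haZ : a ∉ Z ∪ N) (hdZ : d ∉ Z ∪ N)
    (h : G.Connected a d Z) (h' : ¬ G.Connected a d (Z ∪ N)) :
    ∃ z ∈ N, ∃ W, G.MinSeparates a d W ∧ z ∈ W := by
  obtain ⟨W, hW, hmin⟩ := Separates.exists_minSeparates (G := G) ⟨had, haZ, hdZ, h'⟩
  by_contra! hcon
  refine hmin.1.2.2.2 (h.anti hG hZ (fun v hv => (hW hv).resolve_right fun hvN => ?_) had)
  exact hcon v hvN W hmin hv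

/-! ### The link graph -/

/-- The graph on `{x, y} ∪ C` whose edges are the pairs other than `{x, y}` that are joined by a
walk with noncolliders outside `C` and with colliders among the ancestors of its two ends, such that
there are arrowheads at those ends that differ from `x` and `y`. -/
def linkGraph (G : MixedGraph V) (C : Set V) (x y : V) : SimpleGraph V where
  Adj a d := a ≠ d ∧ a ∈ {x, y} ∪ C ∧ d ∈ {x, y} ∪ C ∧ ({a, d} : Set V) ≠ {x, y} ∧
    ∃ b c, G.TripleWalk (G.Allowed (G.ancSet {a, d}) C) a b c d ∧
      (a ∉ ({x, y} : Set V) → G.head b a) ∧ (d ∉ ({x, y} : Set V) → G.head c d)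
  symm := ⟨fun a d => by
    rintro ⟨h1, h2, h3, h4, b, c, h5, h6, h7⟩
    rw [Set.pair_comm] at h4 h5
    exact ⟨h1.symm, h3, h2, h4, c, b, h5.reverse fun _ _ _ => Allowed.symm, h7, h6⟩⟩
  loopless := ⟨fun a h => h.1 rfl⟩

/-- If all adjacent anteriors of `y` are in `C`, then a walk as in the link graph from an
ancestor of `y` to `y` starts with a tail: otherwise, its last node before `y` would be a collider
that is an ancestor of `y`. -/
theorem TripleWalk.not_head_of_ancestor (hG : G.IsAncestral) {C : Set V} {a b c y : V}
    (hC : ∀ v, G.skel.Adj v y → G.Anterior v y → v ∈ C) (hay : G.Ancestor a y)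
    (h : G.TripleWalk (G.Allowed (G.ancSet {a, y}) C) a b c y) : ¬ G.head b a := by
  intro hba
  have hsub : ({a, y} : Set V) ⊆ G.antSet {y} := by
    rintro v (rfl | rfl)
    exacts [⟨y, rfl, hay.anterior⟩, subset_antSet _ rfl]
  rcases (h.inner_anterior hG fun _ _ _ h => h).cases_last with ⟨rfl, rfl⟩ | ⟨e, -, hok, hc⟩
  · exact (hG _ _ hba).1 hay
  · obtain ⟨s, rfl, hcy⟩ :=
      hG.antSet_subset hsub (hG.antSet_union_subset (subset_antSet _) hc)
    have hcol : G.head e c ∧ G.head s c :=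
      not_not.1 fun hn => hok.2 hn (hC c h.adj_last hcy)
    exact (hG _ _ hcol.2).1 (hG.ancestor_of_anterior hcol.2 hcy)

/-- A walk with colliders among the ancestors of its ends that leaves its first node by a directed
edge makes that node an ancestor of the last node. -/
theorem TripleWalk.ancestor_of_tail (hG : G.IsAncestral) {Z : Set V} {a b c d e : V}
    (h : G.TripleWalk (G.Allowed (G.ancSet {a, d}) Z) a b c d) (hea : G.head e a)
    (hba : ¬ G.head b a) : G.Ancestor a d := by
  have hab := hG.directed_of_head hea h.adj_first hba
  obtain ⟨s, hs, hbs⟩ := h.second_ancestor hG hab.1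
  have : b ∈ G.ancSet {a, d} := by
    rcases hs with rfl | hs
    exacts [⟨s, Or.inr rfl, hbs⟩, mem_ancSet_of_ancestor hbs hs]
  obtain ⟨s, rfl | rfl, hbs⟩ := this
  exacts [absurd hbs (hG _ _ hab.1).1, hab.ancestor.trans hbs]

section LinkGraph

variable {C : Set V} {x y : V}

/-- Two edges of the link graph can be merged if the common node is an ancestor of one of the other
two ends. -/
theorem linkGraph_adj_of_ancestor (hG : G.IsAncestral)
    (hC : ∀ w ∈ ({x, y} : Set V), ∀ v, G.skel.Adj v w → G.Anterior v w → v ∈ C) {a b c : V}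
    (hab : (G.linkGraph C x y).Adj a b) (hbc : (G.linkGraph C x y).Adj b c)
    (hb : b ∉ ({x, y} : Set V)) (hac : a ≠ c) (h : G.Ancestor b c) :
    (G.linkGraph C x y).Adj a c := by
  obtain ⟨-, ha, hbC, -, p, q, hw, hp, hq⟩ := hab
  obtain ⟨-, -, hc, -, r, s, hw', hr, hs⟩ := hbc
  refine ⟨hac, ha, hc, fun heq => ?_, p, s, ?_, hp, hs⟩
  · have hcxy : c ∈ ({x, y} : Set V) := heq ▸ Or.inr rfl
    exact hw'.not_head_of_ancestor hG (hC c hcxy) h (hr hb)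
  · have hbac : b ∈ G.ancSet {a, c} := ⟨c, Or.inr rfl, h⟩
    refine (hw.mono fun _ _ _ h => h.mono ?_ subset_rfl).append
      (allowed_of_collider (hq hb) (hr hb) hbac)
      (hw'.mono fun _ _ _ h => h.mono ?_ subset_rfl)
    · rintro v ⟨t, rfl | rfl, hv⟩
      exacts [⟨t, Or.inl rfl, hv⟩, mem_ancSet_of_ancestor hv hbac]
    · rintro v ⟨t, rfl | rfl, hv⟩
      exacts [mem_ancSet_of_ancestor hv hbac, ⟨t, Or.inr rfl, hv⟩]

/-- The link graph joins `x` and `y` if they are connected given `C`: the walk is cut at each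
collider, which is replaced by a descendant in `C`. The induction runs over the rest of the walk;
its part since the last cut, from `d` on, has no colliders. -/
theorem linkGraph_reachable_of_tripleWalk (hG : G.IsAncestral)
    (hC : G.adjAnt {x, y} ⊆ C) (hx : x ∉ C) (hy : y ∉ C) (hxy : ¬ G.skel.Adj x y)
    {u v w : V} (h : G.TripleWalk (G.Allowed (G.ancSet C) C) u v w y) :
    ∀ d b, G.TripleWalk (G.Allowed ∅ C) d b u v → (d = x ∨ d ∈ C ∧ G.head b d) →
      (G.linkGraph C x y).Reachable d y := by
  have hne : ∀ {d e : V}, e ∈ C → ({d, e} : Set V) ≠ {x, y} := by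
    intro d e he heq
    have : e ∈ ({x, y} : Set V) := heq ▸ Or.inr rfl
    rcases this with rfl | rfl
    exacts [hx he, hy he]
  have hmem : ∀ {d b : V}, (d = x ∨ d ∈ C ∧ G.head b d) → d ∈ {x, y} ∪ C := by
    rintro d b (rfl | ⟨hd, -⟩)
    exacts [Or.inl (Or.inl rfl), Or.inr hd]
  have hhead : ∀ {d b : V}, (d = x ∨ d ∈ C ∧ G.head b d) → d ∉ ({x, y} : Set V) → G.head b d := by
    rintro d b (rfl | ⟨-, hd⟩) hn
    exacts [absurd (Or.inl rfl) hn, hd]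
  induction h with
  | @edge u y h =>
    rintro d b hw (rfl | ⟨hd, hbd⟩)
    · exfalso
      rcases (hw.inner_anterior hG fun _ _ _ h => h).cases_last with ⟨rfl, rfl⟩ | ⟨e, -, hok, hc⟩
      · exact hxy h
      · have hu : u ∈ C := by
          refine hC ⟨⟨⟨y, Or.inr rfl, h⟩, by simpa using hc⟩, ?_⟩
          rintro (rfl | rfl)
          exacts [hxy h, h.ne rfl]
        by_cases hcol : G.head e u ∧ G.head y u
        exacts [hok.1 hcol, hok.2 hcol hu]
    · refine SimpleGraph.Adj.reachable ⟨fun h => hy (h ▸ hd), Or.inr hd, Or.inl (Or.inr rfl), ?_,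
        b, u, hw.mono fun _ _ _ h => h.mono (Set.empty_subset _) subset_rfl, fun _ => hbd,
        fun h => absurd (Or.inr rfl) h⟩
      rw [Set.pair_comm]
      exact hne hd
  | @cons u v t w y h hok h2 ih =>
    intro d b hw hd
    have ih := ih hC hy hxy hne hmem hhead
    by_cases hcol : G.head u v ∧ G.head t v
    · obtain ⟨s, hs, hvs⟩ := hok.1 hcol
      obtain ⟨e, he, hve, hcase⟩ := hvs.exists_tripleWalk C
      have heC : e ∈ C := he.elim (fun h => h ▸ hs) id
      -- the part of the walk that ends in `e`, and the part that starts from `e`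
      obtain ⟨⟨c, hc, hce⟩, c', hc', hce'⟩ : (∃ c, G.TripleWalk (G.Allowed ∅ C) d b c e ∧
          G.head c e) ∧ ∃ c', G.TripleWalk (G.Allowed ∅ C) e c' v t ∧ G.head c' e := by
        rcases hcase with rfl | ⟨hvC, p, q, hpq, hp, hq⟩
        · exact ⟨⟨u, hw, hcol.1⟩, t, .edge h2.adj_first, hcol.2⟩
        · exact ⟨⟨q, hw.append (allowed_of_tail hp.2 hvC).symm hpq, hq.1⟩, q,
            (hpq.reverse fun _ _ _ => Allowed.symm).append (allowed_of_tail hp.2 hvC)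
              (.edge h2.adj_first), hq.1⟩
      have hrest := ih e c' hc' (Or.inr ⟨heC, hce'⟩)
      by_cases hde : d = e
      · exact hde ▸ hrest
      · refine SimpleGraph.Reachable.trans (SimpleGraph.Adj.reachable ⟨hde, hmem hd, Or.inr heC,
          hne heC, b, c, hc.mono fun _ _ _ h => h.mono (Set.empty_subset _) subset_rfl,
          hhead hd, fun _ => hce⟩) hrest
    · exact ih d b (hw.append ⟨fun h => absurd h hcol, hok.2⟩ (.edge h2.adj_first)) hd

/-- If enlarging `C` to `F` preserves connectedness (relative to the anteriors of the ends) for all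
pairs in `{x, y} ∪ C` other than `{x, y}`, then each edge of the link graph is an open walk
relative to `F`, and an end that carries no arrowhead is an ancestor of the other end. -/
theorem exists_tripleWalk_of_linkGraph_adj (hG : G.IsAncestral) {F : Set V}
    (hF : ∀ a ∈ {x, y} ∪ C, ∀ d ∈ {x, y} ∪ C, a ≠ d → ({a, d} : Set V) ≠ {x, y} →
      G.Connected a d ((C ∩ G.antSet {a, d}) \ {a, d}) →
      G.Connected a d ((F ∩ G.antSet {a, d}) \ {a, d}))
    {a d : V} (h : (G.linkGraph C x y).Adj a d) :
    ∃ b c, G.TripleWalk (G.Allowed (G.ancSet F) F) a b c d ∧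
      (a ∉ ({x, y} : Set V) → ¬ G.head b a → G.Ancestor a d) ∧
      (d ∉ ({x, y} : Set V) → ¬ G.head c d → G.Ancestor d a) := by
  obtain ⟨had, ha, hd, hne, p, q, hw, hp, hq⟩ := h
  have hcon := hF a ha d hd had hne <| TripleWalk.connected_of_ancSet_ends hG
    (hw.mono fun _ _ _ h => h.mono subset_rfl fun v hv => hv.1.1) (by
      rintro v ⟨s, rfl | rfl, hv⟩
      exacts [Or.inr ⟨_, rfl, hv⟩, Or.inl (Or.inr ⟨_, rfl, hv⟩)])
  set Z := (F ∩ G.antSet {a, d}) \ {a, d} with hZ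
  have hZant : Z ⊆ G.antSet {a, d} := fun v hv => hv.1.2
  obtain ⟨b, c, h⟩ := hcon.exists_tripleWalk_anterior hG hZant had
  have h1 : G.TripleWalk (G.Allowed (G.ancSet {a, d}) Z) a b c d :=
    h.mono fun u v w h =>
      ⟨fun hc => hG.mem_ancSet_of_mem_antSet hc.1 h.2, h.1.1.2⟩
  refine ⟨b, c, h.mono ?_, fun hn => h1.ancestor_of_tail hG (hp hn), fun hn => ?_⟩
  · rintro u v w ⟨⟨hok, hva, hvd⟩, hv⟩
    refine ⟨fun hc => ancSet_mono (fun v hv => hv.1.1) (hok.1 hc),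
      fun hc hvF => hok.2 hc ⟨⟨hvF, hv⟩, ?_⟩⟩
    rintro (h | h)
    exacts [hva h, hvd h]
  · rw [Set.pair_comm] at h1
    exact (h1.reverse fun _ _ _ => Allowed.symm).ancestor_of_tail hG (hq hn)

/-- If enlarging `C` to `F` preserves connectedness (relative to the anteriors of the ends) for all
pairs in `{x, y} ∪ C` other than `{x, y}`, then it does so for `{x, y}`. On a shortest path of the
link graph, no inner node is an ancestor of one of its neighbours, as edges could be merged; hence
the open walks relative to `F` that replace the edges meet in colliders. -/
theorem Connected.of_forall_pair (hG : G.IsAncestral) {F : Set V}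
    (hCF : C ⊆ F) (hC : G.adjAnt {x, y} ⊆ C) (hx : x ∉ C) (hy : y ∉ C) (hne : x ≠ y)
    (hxy : ¬ G.skel.Adj x y)
    (hF : ∀ a ∈ {x, y} ∪ C, ∀ d ∈ {x, y} ∪ C, a ≠ d → ({a, d} : Set V) ≠ {x, y} →
      G.Connected a d ((C ∩ G.antSet {a, d}) \ {a, d}) →
      G.Connected a d ((F ∩ G.antSet {a, d}) \ {a, d}))
    (h : G.Connected x y C) : G.Connected x y F := by
  have hC' : ∀ w ∈ ({x, y} : Set V), ∀ v, G.skel.Adj v w → G.Anterior v w → v ∈ C := by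
    refine fun w hw v hvw hant => hC ⟨⟨⟨w, hw, hvw⟩, w, hw, hant⟩, ?_⟩
    rintro (rfl | rfl) <;> rcases hw with rfl | rfl
    exacts [hvw.ne rfl, hxy hvw, hxy hvw.symm, hvw.ne rfl]
  obtain ⟨b, c, hw⟩ := h.exists_tripleWalk hne
  have hreach : (G.linkGraph C x y).Reachable x y :=
    linkGraph_reachable_of_tripleWalk hG hC hx hy hxy (hw.mono fun _ _ _ h => h.1) x b
      (.edge hw.adj_first) (Or.inl rfl)
  obtain ⟨p, hp, hlen⟩ := hreach.exists_path_of_dist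
  have hadj : ∀ i < p.length, (G.linkGraph C x y).Adj (p.getVert i) (p.getVert (i + 1)) :=
    fun i hi => p.adj_getVert_succ hi
  have hinner : ∀ i, i + 1 < p.length → p.getVert (i + 1) ∉ ({x, y} : Set V) := by
    rintro i hi (h | h)
    · rw [hp.getVert_eq_start_iff (by omega)] at h
      omega
    · rw [Set.mem_singleton_iff, hp.getVert_eq_end_iff (by omega)] at h
      omega
  have hshort : ∀ i, i + 2 ≤ p.length →
      ¬ (G.linkGraph C x y).Adj (p.getVert i) (p.getVert (i + 2)) := by
    intro i hi hcon
    have := SimpleGraph.dist_le ((p.take i).append (.cons hcon (p.drop (i + 2))))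
    simp only [SimpleGraph.Walk.length_append, SimpleGraph.Walk.length_cons,
      SimpleGraph.Walk.take_length, SimpleGraph.Walk.drop_length] at this
    omega
  have hnanc : ∀ i, i + 2 ≤ p.length → ¬ G.Ancestor (p.getVert (i + 1)) (p.getVert i) ∧
      ¬ G.Ancestor (p.getVert (i + 1)) (p.getVert (i + 2)) := by
    intro i hi
    have hdist : p.getVert i ≠ p.getVert (i + 2) := fun heq => by
      have := hp.getVert_injOn (by simp; omega) (by simp; omega) heq
      omega
    have h1 := hadj i (by omega)
    have h2 := hadj (i + 1) (by omega)
    have hin := hinner i (by omega)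
    exact ⟨fun hanc => hshort i hi
        (linkGraph_adj_of_ancestor hG hC' h2.symm h1.symm hin hdist.symm hanc).symm,
      fun hanc => hshort i hi (linkGraph_adj_of_ancestor hG hC' h1 h2 hin hdist hanc)⟩
  have key : ∀ i < p.length, ∃ b c, G.TripleWalk (G.Allowed (G.ancSet F) F) x b c
      (p.getVert (i + 1)) ∧ (i + 1 < p.length → G.head c (p.getVert (i + 1))) := by
    intro i
    induction i with
    | zero =>
      intro hi
      obtain ⟨b, c, hw, -, hc⟩ := exists_tripleWalk_of_linkGraph_adj hG hF (hadj 0 hi)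
      rw [p.getVert_zero] at hw hc
      refine ⟨b, c, hw, fun hi' => ?_⟩
      by_contra hcon
      refine (hnanc 0 hi').1 ?_
      rw [p.getVert_zero]
      exact hc (hinner 0 hi') hcon
    | succ i ih =>
      intro hi
      obtain ⟨b, c, hw, hc⟩ := ih (by omega)
      obtain ⟨b', c', hw', hb', hc'⟩ := exists_tripleWalk_of_linkGraph_adj hG hF (hadj (i + 1) hi)
      have hb : G.head b' (p.getVert (i + 1)) := by
        by_contra hcon
        exact (hnanc i hi).2 (hb' (hinner i hi) hcon)
      have hmem : p.getVert (i + 1) ∈ C := (hadj (i + 1) hi).2.1.resolve_left (hinner i hi)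
      refine ⟨b, c', hw.append (allowed_of_collider (hc hi) hb (subset_ancSet _ (hCF hmem))) hw',
        fun hi' => ?_⟩
      by_contra hcon
      exact (hnanc (i + 1) hi').1 (hc' (hinner (i + 1) hi') hcon)
  have hpos : 0 < p.length := by
    rw [hlen]
    exact hreach.pos_dist_of_ne hne
  obtain ⟨b, c, hw, -⟩ := key (p.length - 1) (by omega)
  rw [show p.length - 1 + 1 = p.length by omega, p.getVert_length] at hw
  exact hw.connected hG

end LinkGraph

/-! ### Sets that separate together with the adjacent anteriors -/

theorem Separates.not_adj {x y : V} {Z : Set V} (h : G.Separates x y Z) : ¬ G.skel.Adj x y := by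
  intro hadj
  refine h.2.2.2 ⟨⟨hadj.toWalk, by simp [hadj.ne]⟩, fun i hi => ?_⟩
  simp at hi

theorem adjAnt_subset_antSet (S : Set V) : G.adjAnt S ⊆ G.antSet S := fun _ hv => hv.1.2

theorem MinSeparatesGiven.subset_antSet (hG : G.IsAncestral) {x y : V} {Z : Set V}
    (h : G.MinSeparatesGiven x y (G.adjAnt {x, y}) Z) : Z ⊆ G.antSet {x, y} := by
  by_contra hcon
  have hlt : Z ∩ G.antSet {x, y} ⊂ Z :=
    ⟨Set.inter_subset_left, fun hle => hcon fun v hv => (hle hv).2⟩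
  refine h.1.2.2.2 ((h.2 _ hlt).of_subset hG
    (Set.union_subset (adjAnt_subset_antSet _) Set.inter_subset_right) h.1.1
    (Set.union_subset_union_right _ Set.inter_subset_left) ?_)
  rintro u (hu | hu) hant - -
  exacts [Or.inl hu, Or.inr ⟨hu, hant⟩]

theorem MinSeparatesGiven.notMem {x y : V} {C Z : Set V}
    (h : G.MinSeparatesGiven x y C Z) {v : V} (hv : v ∈ Z) : v ∉ C := by
  intro hvC
  refine h.1.2.2.2 ?_
  have := h.2 (Z \ {v}) (Set.sdiff_singleton_ssubset.2 hv)
  convert this using 1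
  ext u
  by_cases hu : u = v
  · simp [hu, hvC]
  · simp [hu]

/-- No node of `Z` is adjacent to `x` or `y`, since it would be an adjacent anterior. Further adjacent
nodes do not replace `v`: those that are anterior are present already, the others are useless. -/
theorem MinSeparatesGiven.isDSepNode (hG : G.IsAncestral) {x y : V} {Z : Set V}
    (hxy : G.IsDSepLink x y) (h : G.MinSeparatesGiven x y (G.adjAnt {x, y}) Z) {v : V}
    (hv : v ∈ Z) : G.IsDSepNode x y (G.adjAnt {x, y} ∪ Z) v := by
  have hvxy : v ∉ ({x, y} : Set V) := by
    rintro (rfl | rfl)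
    exacts [h.1.2.1 (Or.inr hv), h.1.2.2.1 (Or.inr hv)]
  have hvadj : v ∉ G.adjSet {x, y} := fun hadj =>
    h.notMem hv ⟨⟨hadj, h.subset_antSet hG hv⟩, hvxy⟩
  refine ⟨⟨h.1, hxy.choose_spec.2⟩, Or.inr hv, hvadj, fun Z' hZ' => ?_⟩
  refine (h.2 (Z \ {v}) (Set.sdiff_singleton_ssubset.2 hv)).of_subset hG
    (Set.union_subset (adjAnt_subset_antSet _) (Set.sdiff_subset.trans (h.subset_antSet hG)))
    h.1.1 ?_ ?_
  · rintro u (hu | hu)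
    · exact Or.inl ⟨Or.inl hu, fun huv => h.notMem hv (huv ▸ hu)⟩
    · exact Or.inl ⟨Or.inr hu.1, hu.2⟩
  · rintro u (⟨hu | hu, huv⟩ | hu) hant hux huy
    · exact Or.inl hu
    · exact Or.inr ⟨hu, huv⟩
    · exact Or.inl ⟨⟨hZ' hu, hant⟩, by simp [hux, huy]⟩

/-- As long as not all nodes of `Z` have been found, a further one belongs to a minimal
separating set between two of the known nodes. -/
theorem MinSeparatesGiven.exists_minSeparates [Finite V] (hG : G.IsAncestral) {x y : V}
    {Z T : Set V} (h : G.MinSeparatesGiven x y (G.adjAnt {x, y}) Z) (hT : T ⊂ Z) :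
    ∃ z ∈ Z \ T, ∃ a ∈ {x, y} ∪ G.adjAnt {x, y} ∪ T, ∃ b ∈ {x, y} ∪ G.adjAnt {x, y} ∪ T,
      ({a, b} : Set V) ≠ {x, y} ∧ ∃ W, G.MinSeparates a b W ∧ z ∈ W := by
  by_contra! hcon
  have hCF : G.adjAnt {x, y} ∪ T ⊆ G.adjAnt {x, y} ∪ Z := Set.union_subset_union_right _ hT.subset
  refine h.1.2.2.2 ((h.2 T hT).of_forall_pair hG hCF Set.subset_union_left
    (fun hx => h.1.2.1 (hCF hx)) (fun hy => h.1.2.2.1 (hCF hy)) h.1.1 h.1.not_adj ?_)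
  rw [← Set.union_assoc]
  intro a ha b hb hab hne hconn
  by_contra hn
  have heq : ((G.adjAnt {x, y} ∪ Z) ∩ G.antSet {a, b}) \ {a, b} =
      ((G.adjAnt {x, y} ∪ T) ∩ G.antSet {a, b}) \ {a, b} ∪
        ((Z \ T) ∩ G.antSet {a, b}) \ {a, b} := by
    ext v
    have := fun h : v ∈ T => hT.subset h
    simp only [Set.mem_sdiff, Set.mem_inter_iff, Set.mem_union]
    tauto
  rw [heq] at hn
  obtain ⟨z, hz, W, hW, hzW⟩ := exists_minSeparates_of_not_connected hG
    (fun v hv => hv.1.2) hab (by simp) (by simp) hconn hn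
  exact hcon z hz.1.1 a ha b hb hne W hW hzW

end MixedGraph

/-! ### Enumerating a set step by step -/

/-- If every proper subset `T` of `S` can be extended by an element `a` of `S` with `R T a`, then `S` can be
enumerated by such extensions. -/
theorem Set.exists_enumeration {α : Type*} {S : Set α} (hS : S.Finite)
    {R : Set α → α → Prop} (h : ∀ T ⊂ S, ∃ a ∈ S \ T, R T a) :
    ∃ (n : ℕ) (z : Fin n → α), Function.Injective z ∧ Set.range z = S ∧
      ∀ i, R (z '' {j | j < i}) (z i) := by
  have key : ∀ k ≤ S.ncard, ∃ z : Fin k → α, Function.Injective z ∧ Set.range z ⊆ S ∧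
      ∀ i, R (z '' {j | j < i}) (z i) := by
    intro k
    induction k with
    | zero =>
      exact fun _ => ⟨Fin.elim0, fun i => i.elim0, by rintro _ ⟨i, -⟩; exact i.elim0,
        fun i => i.elim0⟩
    | succ k ih =>
      intro hk
      obtain ⟨z, hinj, hsub, hR⟩ := ih (by omega)
      have hcard : (Set.range z).ncard = k := by
        rw [← Set.image_univ, Set.ncard_image_of_injective _ hinj, Set.ncard_univ, Nat.card_fin]
      obtain ⟨a, ⟨haS, haz⟩, hRa⟩ := h (Set.range z) (hsub.ssubset_of_ne fun heq => by
        rw [heq] at hcard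
        omega)
      refine ⟨Fin.snoc z a, ?_, ?_, fun i => ?_⟩
      · exact Fin.snoc_injective_iff.2 ⟨hinj, haz⟩
      · rintro _ ⟨i, rfl⟩
        induction i using Fin.lastCases with
        | last => simpa using haS
        | cast i => simpa using hsub ⟨i, rfl⟩
      · induction i using Fin.lastCases with
        | last =>
          convert hRa using 1
          · ext v
            constructor
            · rintro ⟨j, hj, rfl⟩
              induction j using Fin.lastCases with
              | last => exact absurd hj (lt_irrefl (Fin.last k))
              | cast j => exact ⟨j, by simp⟩
            · rintro ⟨j, rfl⟩
              exact ⟨j.castSucc, Fin.castSucc_lt_last j, by simp⟩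
          · simp
        | cast i =>
          convert hR i using 1
          · ext v
            constructor
            · rintro ⟨j, hj, rfl⟩
              induction j using Fin.lastCases with
              | last => exact absurd hj (Fin.castSucc_lt_last i).not_gt
              | cast j => exact ⟨j, by simpa using hj, by simp⟩
            · rintro ⟨j, hj, rfl⟩
              exact ⟨j.castSucc, by simpa using hj, by simp⟩
          · simp
  obtain ⟨z, hinj, hsub, hR⟩ := key _ le_rfl
  refine ⟨_, z, hinj, Set.eq_of_subset_of_ncard_le hsub ?_ hS, hR⟩
  rw [← Set.image_univ, Set.ncard_image_of_injective _ hinj, Set.ncard_univ, Nat.card_fin]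

theorem mainTheorem5 {V : Type*} [Finite V] (M : MixedGraph V) (hM : M.IsMAG) (X Y : V)
    (hXY : M.IsDSepLink X Y) (ZDS : Set V)
    (hZ : M.MinSeparatesGiven X Y (M.adjAnt {X, Y}) ZDS) :
    (∀ v ∈ ZDS, M.IsDSepNode X Y (M.adjAnt {X, Y} ∪ ZDS) v) ∧
    ∃ (n : ℕ) (z : Fin n → V), Function.Injective z ∧ Set.range z = ZDS ∧
      ∀ i : Fin n, ∃ A ∈ {X, Y} ∪ M.adjAnt {X, Y} ∪ z '' {j | j < i},
        ∃ B ∈ {X, Y} ∪ M.adjAnt {X, Y} ∪ z '' {j | j < i},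
          ({A, B} : Set V) ≠ {X, Y} ∧
          ∃ W : Set V, M.MinSeparates A B W ∧ z i ∈ W := by
  refine ⟨fun v hv => hZ.isDSepNode hM.1 hXY hv, ?_⟩
  exact Set.exists_enumeration (R := fun T z => ∃ A ∈ {X, Y} ∪ M.adjAnt {X, Y} ∪ T,
    ∃ B ∈ {X, Y} ∪ M.adjAnt {X, Y} ∪ T, ({A, B} : Set V) ≠ {X, Y} ∧
      ∃ W : Set V, M.MinSeparates A B W ∧ z ∈ W) ZDS.toFinite
    fun T hT => hZ.exists_minSeparates hM.1 hT
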